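/- **Notation.** For $n\ge 1$ let $\mathrm{Cliff}_n(\mathbb R)$ be the associative unital real algebra generated by $i_1,\dots,i_{n-1}$ subject only to $i_hi_k=-i_ki_h$ ($h\ne k$) and $i_h^2=-1$. Let $\alpha\mapsto\alpha^*$ be the linear anti-automorphism that reverses the order of the factors in each product of generators. Let $\mathbb V^n(\mathbb R)$ and $\mathbb V^n(\mathbb Z)$ be the real, respectively integral, linear combinations of $1,i_1,\dots,i_{n-1}$, and let $\Gamma_n(\mathbb R)$ be the group of all finite products of invertible elements of $\mathbb V^n(\mathbb R)$. Let $\mathrm{SL}_+(\Gamma_n(\mathbb R))$ be the set of matrices $\begin{pmatrix}\alpha&\beta\\\gamma&\delta\end{pmatrix}$ with entries in $\Gamma_n(\mathbb R)\cup\{0\}$, with $\alpha\delta^*-\beta\gamma^*=1$ and with $\alpha\beta^*,\gamma\delta^*,\gamma^*\alpha,\delta^*\beta\in\mathbb V^n(\mathbb R)$. Regard $\mathrm{Cliff}_3(\mathbb R)\subset\mathrm{Cliff}_4(\mathbb R)$ as the subalgebra generated by $i_1,i_2$, and let $\mathrm{Cliff}_3(\mathbb Z)=\mathbb Z+\mathbb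 Zi_1+\mathbb Zi_2+\mathbb Zi_1i_2$. Put $\varepsilon_1=\frac12(1+i_1i_2i_3)$ and $\varepsilon_2=\frac12(1-i_1i_2i_3)$; every $\alpha\in\mathrm{Cliff}_4(\mathbb R)$ is uniquely $\varepsilon_1a_1+\varepsilon_2a_2$ with $a_1,a_2\in\mathrm{Cliff}_3(\mathbb R)$. Let $$\tilde\Gamma_4(\mathbb Z)=\{\varepsilon_1a+\varepsilon_2b\mid a,b\in\mathrm{Cliff}_3(\mathbb Z),\ \varepsilon_1a+\varepsilon_2b\in\Gamma_4(\mathbb R)\},$$ and let $\mathrm{SL}_+(\tilde\Gamma_4(\mathbb Z))$ be the set of matrices $\begin{pmatrix}\alpha&\beta\\\gamma&\delta\end{pmatrix}$ with entries in $\tilde\Gamma_4(\mathbb Z)\cup\{0\}$, with $\alpha\delta^*-\beta\gamma^*=1$ and with $\alpha\beta^*,\gamma\delta^*,\gamma^*\alpha,\delta^*\beta\in\mathbb V^4(\mathbb Z)$. Let $\mathbb H(\mathbb R)$ be the Hamilton quaternions and $\mathbb H(\mathbb Z)=\mathbb Z+\mathbb Zi+\mathbb Zj+\mathbb Zk$.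 For $M=\begin{pmatrix}a&b\\c&d\end{pmatrix}\in M_2(\mathbb H(\mathbb R))$ let $$\sigma=\begin{cases}cac^{-1}d-cb & c\ne0,\\ bdb^{-1}a & c=0\neq b,\\ (d-a)a(d-a)^{-1}d & b=c=0,\ a\ne d,\\ a\overline a & b=c=0,\ a=d,\end{cases}$$ and let $\Delta(M)=|\sigma|$ be the Dieudonné determinant. Let $\mathrm{SL}_2(\mathbb H(\mathbb R))$ and $\mathrm{SL}_2(\mathbb H(\mathbb Z))$ be the sets of $2\times2$ matrices with $\Delta=1$ and entries in $\mathbb H(\mathbb R)$, respectively $\mathbb H(\mathbb Z)$. Let $\omega:\mathrm{Cliff}_3(\mathbb R)\to\mathbb H(\mathbb R)$ be the algebra isomorphism with $\omega(i_1)=i$ and $\omega(i_2)=j$, let $\chi_1:\mathrm{Cliff}_4(\mathbb R)\to\mathbb H(\mathbb R)$ be the algebra homomorphism $\varepsilon_1a_1+\varepsilon_2a_2\mapsto\omega(a_1)$, and let $\tilde\chi:M_2(\mathrm{Cliff}_4(\mathbb R))\to M_2(\mathbb H(\mathbb R))$ be $\chi_1$ applied to each entry. **Lemma.** The four sets $\mathrm{SL}_+(\tilde\Gamma_4(\mathbb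 Z))\subseteq\mathrm{SL}_+(\Gamma_4(\mathbb R))$ and $\mathrm{SL}_2(\mathbb H(\mathbb Z))\subseteq\mathrm{SL}_2(\mathbb H(\mathbb R))$ are groups under matrix multiplication, $\tilde\chi$ restricts to a group isomorphism $\chi:\mathrm{SL}_+(\Gamma_4(\mathbb R))\to\mathrm{SL}_2(\mathbb H(\mathbb R))$, and $\chi$ restricts to a group isomorphism from $\mathrm{SL}_+(\tilde\Gamma_4(\mathbb Z))$ onto $\mathrm{SL}_2(\mathbb H(\mathbb Z))$. -/

import Mathlib

open scoped Quaternion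

noncomputable section

namespace CliffordSL

/-! ### The Clifford algebras, with `n - 1` anticommuting generators of square `-1` -/

/-- The negative definite form `v ↦ - ∑ vₕ²` on `ℝ^(n-1)`. -/
def cliffForm (n : ℕ) : QuadraticForm ℝ (Fin (n - 1) → ℝ) :=
  QuadraticMap.weightedSumSquares ℝ (fun _ => (-1 : ℝ))

/-- `Cliff_n(ℝ)`. -/
abbrev Cliff (n : ℕ) : Type := CliffordAlgebra (cliffForm n)

/-- The generators `i_1, …, i_{n-1}` (indexed from `0`). -/
def gen (n : ℕ) (h : Fin (n - 1)) : Cliff n :=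
  CliffordAlgebra.ι (cliffForm n) (Pi.single h 1)

lemma cliffForm_apply (n : ℕ) (v : Fin (n - 1) → ℝ) :
    cliffForm n v = - ∑ h, v h * v h := by
  simp [cliffForm, QuadraticMap.weightedSumSquares_apply]

lemma gen_mul_self (n : ℕ) (h : Fin (n - 1)) : gen n h * gen n h = -1 := by
  rw [gen, CliffordAlgebra.ι_sq_scalar, cliffForm_apply]
  simp [Pi.single_apply]

lemma gen_mul_gen (n : ℕ) {h k : Fin (n - 1)} (hk : h ≠ k) :
    gen n h * gen n k = - (gen n k * gen n h) := by
  rw [eq_neg_iff_add_eq_zero, gen, gen, CliffordAlgebra.ι_mul_ι_add_swap, QuadraticMap.polar]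
  simp only [cliffForm_apply, Pi.add_apply]
  have : ∀ x, (Pi.single h (1 : ℝ) : Fin (n - 1) → ℝ) x *
      (Pi.single k (1 : ℝ) : Fin (n - 1) → ℝ) x = 0 := by
    intro x
    rcases eq_or_ne x h with rfl | hx
    · simp [hk]
    · simp [Pi.single_apply, hx]
  have h2 : ∀ x, ((Pi.single h (1 : ℝ) : Fin (n - 1) → ℝ) x +
      (Pi.single k (1 : ℝ) : Fin (n - 1) → ℝ) x) * ((Pi.single h (1 : ℝ) : Fin (n - 1) → ℝ) x +
      (Pi.single k (1 : ℝ) : Fin (n - 1) → ℝ) x) =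
      (Pi.single h (1 : ℝ) : Fin (n - 1) → ℝ) x * (Pi.single h (1 : ℝ) : Fin (n - 1) → ℝ) x +
      (Pi.single k (1 : ℝ) : Fin (n - 1) → ℝ) x * (Pi.single k (1 : ℝ) : Fin (n - 1) → ℝ) x := by
    intro x
    linear_combination 2 * this x
  simp only [h2, Finset.sum_add_distrib]
  simp

/-- The space `𝕍ⁿ(ℝ)` of Clifford vectors `α₀ + α₁ i_1 + ⋯ + α_{n-1} i_{n-1}`. -/
def vectors (n : ℕ) : Submodule ℝ (Cliff n) :=
  Submodule.span ℝ (insert 1 (Set.range (gen n)))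

/-- `𝕍ⁿ(ℤ)`: the Clifford vectors with integral coefficients. -/
def intVectors (n : ℕ) : Submodule ℤ (Cliff n) :=
  Submodule.span ℤ (insert 1 (Set.range (gen n)))

/-- The Clifford group `Γ_n(ℝ)`: all finite products of invertible vectors. -/
def cliffGroup (n : ℕ) : Submonoid (Cliff n) :=
  Submonoid.closure {α | α ∈ vectors n ∧ IsUnit α}

/-- The reversion `α ↦ α*`. -/
abbrev rev {n : ℕ} (α : Cliff n) : Cliff n := CliffordAlgebra.reverse α

/-- `2 × 2` matrices. -/
abbrev M2 (R : Type) : Type := Matrix (Fin 2) (Fin 2) R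

/-- The pseudo-determinant `α δ* - β γ*`. -/
def vahlenDet {n : ℕ} (M : M2 (Cliff n)) : Cliff n :=
  M 0 0 * rev (M 1 1) - M 0 1 * rev (M 1 0)

/-- The set `GL(Γ_n(ℝ))`. -/
def GLGamma (n : ℕ) : Set (M2 (Cliff n)) :=
  {M | (∀ r s, M r s ∈ cliffGroup n ∨ M r s = 0) ∧ vahlenDet M ≠ 0 ∧
    M 0 0 * rev (M 0 1) ∈ vectors n ∧ M 1 0 * rev (M 1 1) ∈ vectors n ∧
    rev (M 1 0) * M 0 0 ∈ vectors n ∧ rev (M 1 1) * M 0 1 ∈ vectors n}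

/-- The set `SL₊(Γ_n(ℝ))`. -/
def SLPlus (n : ℕ) : Set (M2 (Cliff n)) :=
  {M | M ∈ GLGamma n ∧ vahlenDet M = 1}

/-! ### `Cliff_3 ⊆ Cliff_4` and the central idempotents of `Cliff_4` -/

/-- The linear part of the inclusion `Cliff_3(ℝ) ⊆ Cliff_4(ℝ)`. -/
def inclLin : (Fin (3 - 1) → ℝ) →ₗ[ℝ] Cliff 4 :=
  (CliffordAlgebra.ι (cliffForm 4)).comp
    (LinearMap.pi ![LinearMap.proj (0 : Fin 2), LinearMap.proj (1 : Fin 2), 0] :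
      (Fin 2 → ℝ) →ₗ[ℝ] (Fin 3 → ℝ))

/-- The inclusion `Cliff_3(ℝ) → Cliff_4(ℝ)`, with `i_1 ↦ i_1` and `i_2 ↦ i_2`. -/
def incl : Cliff 3 →ₐ[ℝ] Cliff 4 :=
  CliffordAlgebra.lift (cliffForm 3) ⟨inclLin, fun v => by
    rw [inclLin, LinearMap.comp_apply, CliffordAlgebra.ι_sq_scalar]
    congr 1
    rw [cliffForm_apply, cliffForm_apply]
    change -(∑ h : Fin 3, _) = -(∑ h : Fin 2, _)
    simp [Fin.sum_univ_succ]⟩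

lemma incl_gen_zero : incl (gen 3 (0 : Fin 2)) = gen 4 (0 : Fin 3) := by
  rw [gen, incl, CliffordAlgebra.lift_ι_apply]
  change CliffordAlgebra.ι (cliffForm 4) _ = CliffordAlgebra.ι (cliffForm 4) _
  congr 1
  ext h
  change Fin 3 at h
  fin_cases h <;> simp

lemma incl_gen_one : incl (gen 3 (1 : Fin 2)) = gen 4 (1 : Fin 3) := by
  rw [gen, incl, CliffordAlgebra.lift_ι_apply]
  change CliffordAlgebra.ι (cliffForm 4) _ = CliffordAlgebra.ι (cliffForm 4) _
  congr 1
  ext h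
  change Fin 3 at h
  fin_cases h <;> simp

/-- `Cliff_3(ℤ)`: the integral combinations of `1, i_1, i_2, i_1 i_2`. -/
def cliffThreeInt : Submodule ℤ (Cliff 3) :=
  Submodule.span ℤ {1, gen 3 (0 : Fin 2), gen 3 (1 : Fin 2),
    gen 3 (0 : Fin 2) * gen 3 (1 : Fin 2)}

/-- `ε_1 = (1 + i_1 i_2 i_3) / 2`. -/
def eps1 : Cliff 4 :=
  (1 / 2 : ℝ) • (1 + gen 4 (0 : Fin 3) * gen 4 (1 : Fin 3) * gen 4 (2 : Fin 3))

/-- `ε_2 = (1 - i_1 i_2 i_3) / 2`. -/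
def eps2 : Cliff 4 :=
  (1 / 2 : ℝ) • (1 - gen 4 (0 : Fin 3) * gen 4 (1 : Fin 3) * gen 4 (2 : Fin 3))

/-- `Γ̃_4(ℤ)`. -/
def gammaTilde : Set (Cliff 4) :=
  {α | α ∈ cliffGroup 4 ∧
    ∃ a ∈ cliffThreeInt, ∃ b ∈ cliffThreeInt, α = eps1 * incl a + eps2 * incl b}

/-- The set `SL₊(Γ̃_4(ℤ))`; as in `SL₊(Γ_4(ℝ))`, entries are allowed to vanish. -/
def SLPlusTilde : Set (M2 (Cliff 4)) :=
  {M | (∀ r s, M r s ∈ gammaTilde ∨ M r s = 0) ∧ vahlenDet M = 1 ∧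
    M 0 0 * rev (M 0 1) ∈ intVectors 4 ∧ M 1 0 * rev (M 1 1) ∈ intVectors 4 ∧
    rev (M 1 0) * M 0 0 ∈ intVectors 4 ∧ rev (M 1 1) * M 0 1 ∈ intVectors 4}

/-! ### Quaternions and the Dieudonné determinant -/

/-- `ℍ(ℤ)`: the integral combinations of `1, i, j, k` in `ℍ(ℝ)`. -/
def quatInt : Set ℍ[ℝ] :=
  {q | ∃ x y z w : ℤ, q = ⟨(x : ℝ), (y : ℝ), (z : ℝ), (w : ℝ)⟩}

open scoped Classical in
/-- The pseudo-determinant `σ` of a quaternionic `2 × 2` matrix. -/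
def sigma (M : M2 ℍ[ℝ]) : ℍ[ℝ] :=
  if M 1 0 ≠ 0 then M 1 0 * M 0 0 * (M 1 0)⁻¹ * M 1 1 - M 1 0 * M 0 1
  else if M 0 1 ≠ 0 then M 0 1 * M 1 1 * (M 0 1)⁻¹ * M 0 0
  else if M 0 0 ≠ M 1 1 then
    (M 1 1 - M 0 0) * M 0 0 * (M 1 1 - M 0 0)⁻¹ * M 1 1
  else M 0 0 * star (M 0 0)

/-- The Dieudonné determinant `Δ = |σ|`. -/
def dieudonne (M : M2 ℍ[ℝ]) : ℝ := ‖sigma M‖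

/-- `SL_2(ℍ(ℝ))`. -/
def SL2Real : Set (M2 ℍ[ℝ]) := {M | dieudonne M = 1}

/-- `SL_2(ℍ(ℤ))`. -/
def SL2Int : Set (M2 ℍ[ℝ]) := {M | (∀ r s, M r s ∈ quatInt) ∧ dieudonne M = 1}

/-! ### The maps `ω` and `χ_1` -/

/-- The quaternion `x + y i + z j + w k`. -/
def quat (x y z w : ℝ) : ℍ[ℝ] := ⟨x, y, z, w⟩

@[simp] lemma quat_re (x y z w : ℝ) : (quat x y z w).re = x := rfl
@[simp] lemma quat_imI (x y z w : ℝ) : (quat x y z w).imI = y := rfl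
@[simp] lemma quat_imJ (x y z w : ℝ) : (quat x y z w).imJ = z := rfl
@[simp] lemma quat_imK (x y z w : ℝ) : (quat x y z w).imK = w := rfl

/-- `(v_1, v_2) ↦ v_1 i + v_2 j`. -/
def omegaLin : (Fin (3 - 1) → ℝ) →ₗ[ℝ] ℍ[ℝ] where
  toFun v := quat 0 (v (0 : Fin 2)) (v (1 : Fin 2)) 0
  map_add' v w := by ext <;> simp
  map_smul' c v := by ext <;> simp

lemma omegaLin_apply (v : Fin (3 - 1) → ℝ) :
    omegaLin v = quat 0 (v (0 : Fin 2)) (v (1 : Fin 2)) 0 := rfl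

/-- The algebra homomorphism `Cliff_3(ℝ) → ℍ(ℝ)`, `i_1 ↦ i`, `i_2 ↦ j`. -/
def omegaHom : Cliff 3 →ₐ[ℝ] ℍ[ℝ] :=
  CliffordAlgebra.lift (cliffForm 3) ⟨omegaLin, fun v => by
    rw [cliffForm_apply, omegaLin_apply]
    change _ = algebraMap ℝ ℍ[ℝ] (-(∑ h : Fin 2, v h * v h))
    ext <;> simp [Fin.sum_univ_succ] <;> ring⟩

lemma omegaHom_gen_zero : omegaHom (gen 3 (0 : Fin 2)) = quat 0 1 0 0 := by
  rw [gen, omegaHom, CliffordAlgebra.lift_ι_apply, omegaLin_apply]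
  simp

lemma omegaHom_gen_one : omegaHom (gen 3 (1 : Fin 2)) = quat 0 0 1 0 := by
  rw [gen, omegaHom, CliffordAlgebra.lift_ι_apply, omegaLin_apply]
  simp

/-- The elements `i_1, i_2, i_1 i_2` of `Cliff_3(ℝ)` multiply like `i, j, k`. -/
def cliffThreeBasis : QuaternionAlgebra.Basis (Cliff 3) (-1 : ℝ) 0 (-1) where
  i := gen 3 (0 : Fin 2)
  j := gen 3 (1 : Fin 2)
  k := gen 3 (0 : Fin 2) * gen 3 (1 : Fin 2)
  i_mul_i := by simp [gen_mul_self]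
  j_mul_j := by simp [gen_mul_self]
  i_mul_j := rfl
  j_mul_i := by
    rw [gen_mul_gen 3 (h := (1 : Fin 2)) (k := (0 : Fin 2)) (by decide)]; simp

/-- The inverse of `ω`. -/
def omegaInv : ℍ[ℝ] →ₐ[ℝ] Cliff 3 := QuaternionAlgebra.lift cliffThreeBasis

lemma ι_three (v : Fin 2 → ℝ) : CliffordAlgebra.ι (cliffForm 3) v =
    v 0 • gen 3 (0 : Fin 2) + v 1 • gen 3 (1 : Fin 2) := by
  rw [gen, gen, ← map_smul, ← map_smul, ← map_add]
  congr 1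
  ext h
  change Fin 2 at h
  fin_cases h <;> simp

lemma ι_four (v : Fin 3 → ℝ) : CliffordAlgebra.ι (cliffForm 4) v =
    v 0 • gen 4 (0 : Fin 3) + v 1 • gen 4 (1 : Fin 3) + v 2 • gen 4 (2 : Fin 3) := by
  rw [gen, gen, gen, ← map_smul, ← map_smul, ← map_smul, ← map_add, ← map_add]
  congr 1
  ext h
  change Fin 3 at h
  fin_cases h <;> simp

lemma omegaInv_apply (q : ℍ[ℝ]) : omegaInv q = algebraMap ℝ _ q.re + q.imI • gen 3 (0 : Fin 2) +
    q.imJ • gen 3 (1 : Fin 2) + q.imK • (gen 3 (0 : Fin 2) * gen 3 (1 : Fin 2)) := rfl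

/-- The algebra isomorphism `ω : Cliff_3(ℝ) ≃ ℍ(ℝ)` with `i_1 ↦ i`, `i_2 ↦ j` (and hence
`i_1 i_2 ↦ k`). -/
def omega : Cliff 3 ≃ₐ[ℝ] ℍ[ℝ] :=
  AlgEquiv.ofAlgHom omegaHom omegaInv
    (by
      refine AlgHom.ext fun q => ?_
      simp only [AlgHom.comp_apply, omegaInv_apply, map_add, map_smul, map_mul,
        omegaHom_gen_zero, omegaHom_gen_one, AlgHom.commutes]
      ext <;> simp)
    (by
      refine CliffordAlgebra.hom_ext (LinearMap.ext fun v => ?_)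
      change omegaInv (omegaHom (CliffordAlgebra.ι (cliffForm 3) v)) =
        CliffordAlgebra.ι (cliffForm 3) v
      rw [ι_three v]
      simp only [map_add, map_smul, omegaHom_gen_zero, omegaHom_gen_one]
      rw [omegaInv_apply, omegaInv_apply]
      simp)

lemma omega_gen : omega (gen 3 (0 : Fin 2)) = quat 0 1 0 0 ∧
    omega (gen 3 (1 : Fin 2)) = quat 0 0 1 0 ∧
    omega (gen 3 (0 : Fin 2) * gen 3 (1 : Fin 2)) = quat 0 0 0 1 := by
  refine ⟨omegaHom_gen_zero, omegaHom_gen_one, ?_⟩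
  change omegaHom (gen 3 (0 : Fin 2) * gen 3 (1 : Fin 2)) = _
  rw [map_mul, omegaHom_gen_zero, omegaHom_gen_one]
  ext <;> simp

/-- `(v_1, v_2, v_3) ↦ v_1 i + v_2 j - v_3 k`. -/
def chi1Lin : (Fin (4 - 1) → ℝ) →ₗ[ℝ] ℍ[ℝ] where
  toFun v := quat 0 (v (0 : Fin 3)) (v (1 : Fin 3)) (-v (2 : Fin 3))
  map_add' v w := by ext <;> simp; ring
  map_smul' c v := by ext <;> simp

lemma chi1Lin_apply (v : Fin (4 - 1) → ℝ) :
    chi1Lin v = quat 0 (v (0 : Fin 3)) (v (1 : Fin 3)) (-v (2 : Fin 3)) := rfl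

/-- The algebra homomorphism `χ_1 : Cliff_4(ℝ) → ℍ(ℝ)`, given on generators by `i_1 ↦ i`,
`i_2 ↦ j`, `i_3 ↦ -k`. By `chi1_eps` and `existsUnique_eps` below, it is the map
`ε_1 a_1 + ε_2 a_2 ↦ ω a_1`. -/
def chi1 : Cliff 4 →ₐ[ℝ] ℍ[ℝ] :=
  CliffordAlgebra.lift (cliffForm 4) ⟨chi1Lin, fun v => by
    rw [cliffForm_apply, chi1Lin_apply]
    change _ = algebraMap ℝ ℍ[ℝ] (-(∑ h : Fin 3, v h * v h))
    ext <;> simp [Fin.sum_univ_succ] <;> ring⟩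

/-- `(v_1, v_2, v_3) ↦ v_1 i + v_2 j + v_3 k`. -/
def chi2Lin : (Fin (4 - 1) → ℝ) →ₗ[ℝ] ℍ[ℝ] where
  toFun v := quat 0 (v (0 : Fin 3)) (v (1 : Fin 3)) (v (2 : Fin 3))
  map_add' v w := by ext <;> simp
  map_smul' c v := by ext <;> simp

lemma chi2Lin_apply (v : Fin (4 - 1) → ℝ) :
    chi2Lin v = quat 0 (v (0 : Fin 3)) (v (1 : Fin 3)) (v (2 : Fin 3)) := rfl

/-- The companion of `chi1` with `i_3 ↦ k`, used only to prove uniqueness in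
`existsUnique_eps`. -/
def chi2 : Cliff 4 →ₐ[ℝ] ℍ[ℝ] :=
  CliffordAlgebra.lift (cliffForm 4) ⟨chi2Lin, fun v => by
    rw [cliffForm_apply, chi2Lin_apply]
    change _ = algebraMap ℝ ℍ[ℝ] (-(∑ h : Fin 3, v h * v h))
    ext <;> simp [Fin.sum_univ_succ] <;> ring⟩

lemma chi1_gen : chi1 (gen 4 (0 : Fin 3)) = quat 0 1 0 0 ∧
    chi1 (gen 4 (1 : Fin 3)) = quat 0 0 1 0 ∧ chi1 (gen 4 (2 : Fin 3)) = quat 0 0 0 (-1) := by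
  refine ⟨?_, ?_, ?_⟩ <;> rw [gen, chi1, CliffordAlgebra.lift_ι_apply, chi1Lin_apply] <;> simp

lemma chi2_gen : chi2 (gen 4 (0 : Fin 3)) = quat 0 1 0 0 ∧
    chi2 (gen 4 (1 : Fin 3)) = quat 0 0 1 0 ∧ chi2 (gen 4 (2 : Fin 3)) = quat 0 0 0 1 := by
  refine ⟨?_, ?_, ?_⟩ <;> rw [gen, chi2, CliffordAlgebra.lift_ι_apply, chi2Lin_apply] <;> simp

lemma chi1_incl (a : Cliff 3) : chi1 (incl a) = omega a := by
  have : chi1.comp incl = omegaHom := by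
    refine CliffordAlgebra.hom_ext (LinearMap.ext fun v => ?_)
    change chi1 (incl (CliffordAlgebra.ι (cliffForm 3) v)) =
      omegaHom (CliffordAlgebra.ι (cliffForm 3) v)
    rw [ι_three v]
    simp only [map_add, map_smul, incl_gen_zero, incl_gen_one, chi1_gen, omegaHom_gen_zero,
      omegaHom_gen_one]
  exact DFunLike.congr_fun this a

lemma chi2_incl (a : Cliff 3) : chi2 (incl a) = omega a := by
  have : chi2.comp incl = omegaHom := by
    refine CliffordAlgebra.hom_ext (LinearMap.ext fun v => ?_)
    change chi2 (incl (CliffordAlgebra.ι (cliffForm 3) v)) =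
      omegaHom (CliffordAlgebra.ι (cliffForm 3) v)
    rw [ι_three v]
    simp only [map_add, map_smul, incl_gen_zero, incl_gen_one, chi2_gen, omegaHom_gen_zero,
      omegaHom_gen_one]
  exact DFunLike.congr_fun this a

lemma chi1_eps (a b : Cliff 3) : chi1 (eps1 * incl a + eps2 * incl b) = omega a := by
  have h1 : chi1 eps1 = 1 := by
    simp only [eps1, map_smul, map_add, map_mul, map_one, chi1_gen]
    ext <;> simp; norm_num
  have h2 : chi1 eps2 = 0 := by
    simp only [eps2, map_smul, map_sub, map_mul, map_one, chi1_gen]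
    ext <;> simp
  rw [map_add, map_mul, map_mul, h1, h2, chi1_incl]; simp

lemma chi2_eps (a b : Cliff 3) : chi2 (eps1 * incl a + eps2 * incl b) = omega b := by
  have h1 : chi2 eps1 = 0 := by
    simp only [eps1, map_smul, map_add, map_mul, map_one, chi2_gen]
    ext <;> simp
  have h2 : chi2 eps2 = 1 := by
    simp only [eps2, map_smul, map_sub, map_mul, map_one, chi2_gen]
    ext <;> simp; norm_num
  rw [map_add, map_mul, map_mul, h1, h2, chi2_incl b]; simp

lemma gen_relations :
    (gen 4 (1 : Fin 3) * gen 4 (0 : Fin 3) = -(gen 4 (0 : Fin 3) * gen 4 (1 : Fin 3))) ∧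
    (gen 4 (2 : Fin 3) * gen 4 (0 : Fin 3) = -(gen 4 (0 : Fin 3) * gen 4 (2 : Fin 3))) ∧
    (gen 4 (2 : Fin 3) * gen 4 (1 : Fin 3) = -(gen 4 (1 : Fin 3) * gen 4 (2 : Fin 3))) :=
  ⟨gen_mul_gen 4 (h := (1 : Fin 3)) (k := (0 : Fin 3)) (by decide),
    gen_mul_gen 4 (h := (2 : Fin 3)) (k := (0 : Fin 3)) (by decide),
    gen_mul_gen 4 (h := (2 : Fin 3)) (k := (1 : Fin 3)) (by decide)⟩

/-- Computations with three anticommuting square roots of `-1`. -/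
lemma omega_relations {A : Type} [Ring A] {x y z : A} (hx : x * x = -1) (hy : y * y = -1)
    (hz : z * z = -1) (hyx : y * x = -(x * y)) (hzx : z * x = -(x * z))
    (hzy : z * y = -(y * z)) :
    Commute (x * y * z) x ∧ Commute (x * y * z) y ∧ Commute (x * y * z) z ∧
      (x * y * z) * (x * y * z) = 1 ∧ z = -((x * y * z) * (x * y)) := by
  have hx' : ∀ t, x * (x * t) = -t := fun t => by rw [← mul_assoc, hx]; simp
  have hy' : ∀ t, y * (y * t) = -t := fun t => by rw [← mul_assoc, hy]; simp
  have hyx' : ∀ t, y * (x * t) = -(x * (y * t)) := fun t => by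
    rw [← mul_assoc, hyx]; simp [mul_assoc]
  have hzx' : ∀ t, z * (x * t) = -(x * (z * t)) := fun t => by
    rw [← mul_assoc, hzx]; simp [mul_assoc]
  have hzy' : ∀ t, z * (y * t) = -(y * (z * t)) := fun t => by
    rw [← mul_assoc, hzy]; simp [mul_assoc]
  refine ⟨?_, ?_, ?_, ?_, ?_⟩ <;>
    simp [Commute, SemiconjBy, mul_assoc, hx, hy, hz, hx', hy', hzx, hzy, hyx', hzx', hzy']

/-- `i_1 i_2 i_3` is central in `Cliff_4(ℝ)`. -/
lemma commute_triple (α : Cliff 4) :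
    Commute (gen 4 (0 : Fin 3) * gen 4 (1 : Fin 3) * gen 4 (2 : Fin 3)) α := by
  obtain ⟨h0, h1, h2, -, -⟩ := omega_relations (gen_mul_self 4 (0 : Fin 3))
    (gen_mul_self 4 (1 : Fin 3)) (gen_mul_self 4 (2 : Fin 3)) gen_relations.1
    gen_relations.2.1 gen_relations.2.2
  induction α using CliffordAlgebra.induction with
  | algebraMap r => exact (Algebra.commutes r _).symm
  | ι v =>
    rw [ι_four v]
    exact ((h0.smul_right _).add_right (h1.smul_right _)).add_right (h2.smul_right _)
  | mul a b ha hb => exact ha.mul_right hb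
  | add a b ha hb => exact ha.add_right hb

lemma eps_relations : eps1 * eps1 = eps1 ∧ eps2 * eps2 = eps2 ∧ eps1 * eps2 = 0 ∧
    eps2 * eps1 = 0 ∧ eps1 + eps2 = 1 := by
  obtain ⟨-, -, -, hw, -⟩ := omega_relations (gen_mul_self 4 (0 : Fin 3))
    (gen_mul_self 4 (1 : Fin 3)) (gen_mul_self 4 (2 : Fin 3)) gen_relations.1
    gen_relations.2.1 gen_relations.2.2
  unfold eps1 eps2
  generalize gen 4 (0 : Fin 3) * gen 4 (1 : Fin 3) * gen 4 (2 : Fin 3) = w at *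
  refine ⟨?_, ?_, ?_, ?_, ?_⟩
  · rw [smul_mul_smul_comm, add_mul, mul_add, mul_add, hw]; simp only [one_mul, mul_one]; module
  · rw [smul_mul_smul_comm, sub_mul, mul_sub, mul_sub, hw]; simp only [one_mul, mul_one]; module
  · rw [smul_mul_smul_comm, add_mul, mul_sub, mul_sub, hw]; simp only [one_mul, mul_one]; module
  · rw [smul_mul_smul_comm, sub_mul, mul_add, mul_add, hw]; simp only [one_mul, mul_one]; module
  · module

lemma eps_central (α : Cliff 4) : Commute eps1 α ∧ Commute eps2 α :=
  ⟨((Commute.one_left α).add_left (commute_triple α)).smul_left _,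
    ((Commute.one_left α).sub_left (commute_triple α)).smul_left _⟩

lemma exists_eps (α : Cliff 4) : ∃ a b : Cliff 3, α = eps1 * incl a + eps2 * incl b := by
  obtain ⟨h11, h22, h12, h21, hs⟩ := eps_relations
  have hdiag : ∀ a : Cliff 3, incl a = eps1 * incl a + eps2 * incl a := fun a => by
    rw [← add_mul, hs, one_mul]
  induction α using CliffordAlgebra.induction with
  | algebraMap r =>
    exact ⟨algebraMap ℝ _ r, algebraMap ℝ _ r, by rw [← hdiag, AlgHom.commutes]⟩
  | ι v =>
    obtain ⟨-, -, -, -, hz⟩ := omega_relations (gen_mul_self 4 (0 : Fin 3))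
      (gen_mul_self 4 (1 : Fin 3)) (gen_mul_self 4 (2 : Fin 3)) gen_relations.1
      gen_relations.2.1 gen_relations.2.2
    have hz' : gen 4 (2 : Fin 3) =
        eps1 * incl (-(gen 3 (0 : Fin 2) * gen 3 (1 : Fin 2))) +
          eps2 * incl (gen 3 (0 : Fin 2) * gen 3 (1 : Fin 2)) := by
      rw [map_neg, map_mul, incl_gen_zero, incl_gen_one, mul_neg]
      conv_lhs => rw [hz]
      unfold eps1 eps2
      rw [smul_mul_assoc, smul_mul_assoc, add_mul, sub_mul]
      module
    refine ⟨ (v (0 : Fin 3)) • gen 3 (0 : Fin 2) + (v (1 : Fin 3)) • gen 3 (1 : Fin 2) +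
        (v (2 : Fin 3)) • -(gen 3 (0 : Fin 2) * gen 3 (1 : Fin 2)),
      (v (0 : Fin 3)) • gen 3 (0 : Fin 2) + (v (1 : Fin 3)) • gen 3 (1 : Fin 2) +
        (v (2 : Fin 3)) • (gen 3 (0 : Fin 2) * gen 3 (1 : Fin 2)), ?_⟩
    rw [ι_four v, hz', ← incl_gen_zero, ← incl_gen_one]
    conv_lhs => rw [hdiag (gen 3 (0 : Fin 2)), hdiag (gen 3 (1 : Fin 2))]
    simp only [map_add, map_smul, mul_add, mul_smul_comm]
    module
  | mul x y hx hy =>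
    obtain ⟨a, b, rfl⟩ := hx
    obtain ⟨c, d, rfl⟩ := hy
    refine ⟨a * c, b * d, ?_⟩
    have e1 : ∀ p q : Cliff 4, eps1 * p * (eps1 * q) = eps1 * (p * q) := fun p q => by
      rw [mul_assoc, ← mul_assoc p, ← (eps_central p).1.eq, mul_assoc, ← mul_assoc, h11]
    have e2 : ∀ p q : Cliff 4, eps2 * p * (eps2 * q) = eps2 * (p * q) := fun p q => by
      rw [mul_assoc, ← mul_assoc p, ← (eps_central p).2.eq, mul_assoc, ← mul_assoc, h22]
    have e3 : ∀ p q : Cliff 4, eps1 * p * (eps2 * q) = 0 := fun p q => by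
      rw [mul_assoc, ← mul_assoc p, ← (eps_central p).2.eq, mul_assoc, ← mul_assoc, h12, zero_mul]
    have e4 : ∀ p q : Cliff 4, eps2 * p * (eps1 * q) = 0 := fun p q => by
      rw [mul_assoc, ← mul_assoc p, ← (eps_central p).1.eq, mul_assoc, ← mul_assoc, h21, zero_mul]
    rw [add_mul, mul_add, mul_add, e1, e2, e3, e4, map_mul, map_mul]
    simp
  | add x y hx hy =>
    obtain ⟨a, b, rfl⟩ := hx
    obtain ⟨c, d, rfl⟩ := hy
    refine ⟨a + c, b + d, ?_⟩
    rw [map_add, map_add, mul_add, mul_add]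
    abel

/-- Every element of `Cliff_4(ℝ)` is `ε_1 a_1 + ε_2 a_2` for unique `a_1, a_2 ∈ Cliff_3(ℝ)`. -/
lemma existsUnique_eps (α : Cliff 4) :
    ∃! p : Cliff 3 × Cliff 3, α = eps1 * incl p.1 + eps2 * incl p.2 := by
  obtain ⟨a, b, h⟩ := exists_eps α
  refine ⟨(a, b), h, ?_⟩
  rintro ⟨c, d⟩ h'
  have h1 := congrArg chi1 (h.symm.trans h')
  have h2 := congrArg chi2 (h.symm.trans h')
  simp only [chi1_eps, chi2_eps] at h1 h2
  exact Prod.ext (omega.injective h1).symm (omega.injective h2).symm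

/-- The homomorphism `χ̃ : M_2(Cliff_4(ℝ)) → M_2(ℍ(ℝ))`, entrywise `χ_1`. -/
def chiTilde : M2 (Cliff 4) →ₐ[ℝ] M2 ℍ[ℝ] := chi1.mapMatrix

end CliffordSL

end

/-!
Through `x ↦ (χ₁ x, χ₁ x*)` the algebra `Cliff_4(ℝ)` becomes `ℍ × ℍᵒᵖ`, with reversion exchanging
the two factors. The vectors are the diagonal pairs, and since every unit quaternion is a
commutator, `Γ_4(ℝ)` consists of all pairs of quaternions of equal nonzero norm.

Let `M†` be the matrix `(δ*, -β*; -γ*, α*)`. The conditions defining `SL_+`, other than those on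
the entries, say that `M M† = 1`, so `M ↦ (χ̃ M, χ̃ M†)` identifies their solutions with the pairs
`(v, v⁻¹)`, `v ∈ GL_2(ℍ(ℝ))`. The entries of `M` lie in `Γ_4(ℝ) ∪ {0}` when each entry of `v⁻¹`
has the same norm as the complementary entry of `v`. By Cramer's rule for the Study determinant,
which is the square of the Dieudonné determinant, this means `Δ(v) = 1`. The adjugate formula then
makes `v⁻¹` integral when `v` is.
-/

open scoped Matrix

noncomputable section

namespace CliffordSL

section QuaternionMatrix

open Quaternion

variable {R : Type*} [CommRing R]

/-- The determinant of a Hermitian `2 × 2` matrix of quaternions. -/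
def hermDet (H : Matrix (Fin 2) (Fin 2) ℍ[R]) : R :=
  (H 0 0).re * (H 1 1).re - normSq (H 0 1)

/-- The adjugate of a Hermitian `2 × 2` matrix of quaternions. -/
def hermAdj (H : Matrix (Fin 2) (Fin 2) ℍ[R]) : Matrix (Fin 2) (Fin 2) ℍ[R] :=
  !![H 1 1, -H 0 1; -H 1 0, H 0 0]

variable [NoZeroDivisors R] [CharZero R] {H : Matrix (Fin 2) (Fin 2) ℍ[R]}

lemma eq_of_isHermitian (hH : H.IsHermitian) :
    H = !![((H 0 0).re : ℍ[R]), H 0 1; star (H 0 1), ((H 1 1).re : ℍ[R])] := by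
  conv_lhs => rw [H.eta_fin_two, ← hH.apply 1 0, star_eq_self.1 (hH.apply 0 0),
    star_eq_self.1 (hH.apply 1 1)]

lemma mul_hermAdj (hH : H.IsHermitian) : H * hermAdj H = hermDet H • 1 := by
  rw [eq_of_isHermitian hH]
  generalize (H 0 0).re = x, H 0 1 = z, (H 1 1).re = y
  have hz (t : R) : z * (t : ℍ[R]) = t * z := (coe_commutes t z).symm
  have hz' (t : R) : star z * (t : ℍ[R]) = t * star z := (coe_commutes t (star z)).symm
  ext1 r s
  fin_cases r <;> fin_cases s <;>
    simp [hermAdj, hermDet, Matrix.mul_apply, self_mul_star, star_mul_self, hz, hz', ← coe_mul,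
      ← coe_sub, ← sub_eq_add_neg, neg_add_eq_sub, mul_comm y, ← coe_mul_eq_smul]

lemma hermDet_mul_mul_conjTranspose (hH : H.IsHermitian) (M : Matrix (Fin 2) (Fin 2) ℍ[R]) :
    hermDet (M * H * Mᴴ) = hermDet (M * Mᴴ) * hermDet H := by
  rw [eq_of_isHermitian hH]
  simp only [hermDet, normSq_def', Matrix.mul_apply, Fin.sum_univ_two, Matrix.conjTranspose_apply,
    Matrix.of_apply, Matrix.cons_val_zero, Matrix.cons_val_one, Matrix.cons_val',
    Matrix.cons_val_fin_one, re_add, re_mul, imI_mul, imJ_mul, imK_mul, imI_add, imJ_add, imK_add,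
    re_star, imI_star, imJ_star, imK_star, re_coe, imI_coe, imJ_coe, imK_coe]
  ring

/-- The Study determinant of a `2 × 2` matrix of quaternions, the square of its Dieudonné
determinant (`normSq_sigma`). -/
def studyDet : Matrix (Fin 2) (Fin 2) ℍ[R] →* R where
  toFun M := hermDet (M * Mᴴ)
  map_one' := by simp [hermDet]
  map_mul' M N := by
    rw [← hermDet_mul_mul_conjTranspose (Matrix.isHermitian_mul_conjTranspose_self N),
      Matrix.conjTranspose_mul]
    simp only [Matrix.mul_assoc]

/-- The adjugate with respect to the Study determinant. -/
def studyAdj (M : Matrix (Fin 2) (Fin 2) ℍ[R]) : Matrix (Fin 2) (Fin 2) ℍ[R] :=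
  Mᴴ * hermAdj (M * Mᴴ)

variable (M N : Matrix (Fin 2) (Fin 2) ℍ[R])

lemma mul_studyAdj : M * studyAdj M = studyDet M • 1 := by
  rw [studyAdj, ← Matrix.mul_assoc]
  exact mul_hermAdj (Matrix.isHermitian_mul_conjTranspose_self M)

lemma studyDet_apply : studyDet M =
    normSq (M 0 0) * normSq (M 1 1) + normSq (M 0 1) * normSq (M 1 0) -
      2 * (M 0 0 * star (M 1 0) * M 1 1 * star (M 0 1)).re := by
  simp only [studyDet, MonoidHom.coe_mk, OneHom.coe_mk, hermDet, Matrix.mul_apply,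
    Fin.sum_univ_two, Matrix.conjTranspose_apply, re_add, normSq_add, ← normSq_def, map_mul,
    normSq_star]
  simp only [star_mul, star_star, ← mul_assoc]
  ring

lemma studyDet_updateCol_one (j : Fin 2) (w : Fin 2 → ℍ[R]) :
    studyDet (Matrix.updateCol 1 j w) = normSq (w j) := by
  fin_cases j <;> simp [studyDet_apply]

lemma studyDet_updateCol_single (j s : Fin 2) :
    studyDet (M.updateCol j (Pi.single s 1)) = normSq (M s.rev j.rev) := by
  fin_cases j <;> fin_cases s <;> simp [studyDet_apply]

variable {M N}

lemma studyDet_mul_normSq (h : M * N = 1) (r s : Fin 2) :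
    studyDet M * normSq (N r s) = normSq (M s.rev r.rev) :=
  calc studyDet M * normSq (N r s)
      = studyDet (M * Matrix.updateCol 1 r (N.col s)) := by
        rw [map_mul, studyDet_updateCol_one, Matrix.col_apply]
    _ = studyDet (M.updateCol r (Pi.single s 1)) := by
        have hcol : M *ᵥ N.col s = Pi.single s 1 := by
          rw [← N.mulVec_single_one, Matrix.mulVec_mulVec, h, Matrix.one_mulVec]
        rw [Matrix.mul_updateCol, Matrix.mul_one, hcol]
    _ = normSq (M s.rev r.rev) := studyDet_updateCol_single M r s

end QuaternionMatrix

section Dieudonne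

open Quaternion

lemma normSq_sigma (M : M2 ℍ[ℝ]) : normSq (sigma M) = studyDet M := by
  unfold sigma
  split_ifs with hc hb had
  · have hM : M = !![1, M 0 0 * (M 1 0)⁻¹; 0, 1] *
        !![0, M 0 1 - M 0 0 * (M 1 0)⁻¹ * M 1 1; M 1 0, M 1 1] := by
      conv_lhs => rw [M.eta_fin_two]
      simp [inv_mul_cancel₀ hc, mul_assoc]
    have hσ : M 1 0 * M 0 0 * (M 1 0)⁻¹ * M 1 1 - M 1 0 * M 0 1 =
        -(M 1 0 * (M 0 1 - M 0 0 * (M 1 0)⁻¹ * M 1 1)) := by noncomm_ring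
    conv_rhs => rw [hM, map_mul]
    rw [hσ]
    simp [studyDet_apply, mul_comm]
  · have hb' : normSq (M 0 1) ≠ 0 := normSq_ne_zero.2 hb
    simp only [studyDet_apply, not_not.1 hc, map_mul, map_inv₀, map_zero, star_zero, mul_zero,
      zero_mul, re_zero, add_zero, sub_zero]
    field_simp
  · have hd : normSq (M 1 1 - M 0 0) ≠ 0 := normSq_ne_zero.2 (sub_ne_zero.2 (Ne.symm had))
    simp only [studyDet_apply, not_not.1 hc, not_not.1 hb, map_mul, map_inv₀, map_zero, star_zero,
      mul_zero, re_zero]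
    field_simp
    ring
  · simp [studyDet_apply, not_not.1 hc, not_not.1 hb, not_not.1 had]

lemma mem_SL2Real {M : M2 ℍ[ℝ]} : M ∈ SL2Real ↔ studyDet M = 1 := by
  rw [← normSq_sigma, normSq_eq_norm_mul_self, ← sq,
    pow_eq_one_iff_of_nonneg (norm_nonneg _) two_ne_zero]
  rfl

lemma mem_SL2Real_iff_normSq_eq {M N : M2 ℍ[ℝ]} (h : M * N = 1) :
    M ∈ SL2Real ↔ ∀ r s, normSq (N r s) = normSq (M s.rev r.rev) := by
  rw [mem_SL2Real]
  simp_rw [← studyDet_mul_normSq h]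
  refine ⟨fun hM r s => by rw [hM, one_mul], fun hN => ?_⟩
  obtain ⟨r, s, hrs⟩ : ∃ r s, N r s ≠ 0 := by
    by_contra! hN0
    simp [show N = 0 from Matrix.ext hN0] at h
  exact (mul_eq_right₀ (normSq_ne_zero.2 hrs)).1 (hN r s).symm

end Dieudonne

section Commutator

open Quaternion

lemma exists_ne_zero_re_eq_zero_orthogonal {R : Type*} [CommRing R] [Nontrivial R] (u : ℍ[R]) :
    ∃ q : ℍ[R], q ≠ 0 ∧ q.re = 0 ∧ u.imI * q.imI + u.imJ * q.imJ + u.imK * q.imK = 0 := by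
  by_cases hI : u.imI = 0
  · exact ⟨⟨0, 1, 0, 0⟩, mt (congrArg (·.imI)) one_ne_zero, rfl, by simp [hI]⟩
  · exact ⟨⟨0, -u.imJ, u.imI, 0⟩, mt (congrArg (·.imJ)) hI, rfl, by simp [mul_comm]⟩

lemma mul_eq_star_mul_of_orthogonal {R : Type*} [CommRing R] {u q : ℍ[R]} (hre : q.re = 0)
    (horth : u.imI * q.imI + u.imJ * q.imJ + u.imK * q.imK = 0) : q * u = star u * q := by
  ext <;> simp only [re_mul, imI_mul, imJ_mul, imK_mul, re_star, imI_star, imJ_star, imK_star, hre]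
  · linear_combination -2 * horth
  all_goals ring

open scoped commutatorElement in
lemma exists_commutatorElement_eq {R : Type*} [Field R] [LinearOrder R] [IsStrictOrderedRing R]
    {u : ℍ[R]} (hu : normSq u = 1) :
    ∃ p q : ℍ[R]ˣ, (⁅p, q⁆ : ℍ[R]ˣ) = u := by
  suffices ∃ p q : ℍ[R], p ≠ 0 ∧ q ≠ 0 ∧ p * q = u * (q * p) by
    obtain ⟨p, q, hp, hq, h⟩ := this
    refine ⟨Units.mk0 p hp, Units.mk0 q hq, ?_⟩
    simp only [commutatorElement_def, Units.val_mul, Units.val_inv_eq_inv_val, Units.val_mk0]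
    rw [mul_inv_eq_iff_eq_mul₀ hq, mul_inv_eq_iff_eq_mul₀ hp, mul_assoc, h]
  by_cases h : u = -1
  · obtain ⟨p, hp, hpre, -⟩ := exists_ne_zero_re_eq_zero_orthogonal (0 : ℍ[R])
    obtain ⟨q, hq, hqre, horth⟩ := exists_ne_zero_re_eq_zero_orthogonal p
    refine ⟨p, q, hp, hq, ?_⟩
    rw [h, mul_eq_star_mul_of_orthogonal hqre horth, star_eq_neg.2 hpre]
    simp
  · obtain ⟨q, hq, hqre, horth⟩ := exists_ne_zero_re_eq_zero_orthogonal u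
    refine ⟨u + 1, q, fun hp => h (eq_neg_of_add_eq_zero_left hp), hq, ?_⟩
    have hqu := mul_eq_star_mul_of_orthogonal hqre horth
    rw [mul_add, hqu, mul_add, ← mul_assoc, self_mul_star, hu]
    simp only [coe_one, one_mul, mul_one, add_mul, add_comm]

end Commutator

section IntegralQuaternions

lemma mem_quatInt {q : ℍ[ℝ]} : q ∈ quatInt ↔ ∃ x y z w : ℤ, q = quat x y z w := Iff.rfl

/-- The ring `ℍ(ℤ)` of integral quaternions. -/
def quatIntSubring : Subring ℍ[ℝ] where
  carrier := quatInt
  zero_mem' := ⟨0, 0, 0, 0, by ext <;> simp⟩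
  one_mem' := ⟨1, 0, 0, 0, by ext <;> simp⟩
  add_mem' := by
    simp only [mem_quatInt]
    rintro _ _ ⟨a, b, c, d, rfl⟩ ⟨e, f, g, h, rfl⟩
    exact ⟨a + e, b + f, c + g, d + h, by ext <;> simp⟩
  neg_mem' := by
    simp only [mem_quatInt]
    rintro _ ⟨a, b, c, d, rfl⟩
    exact ⟨-a, -b, -c, -d, by ext <;> simp⟩
  mul_mem' := by
    simp only [mem_quatInt]
    rintro _ _ ⟨a, b, c, d, rfl⟩ ⟨e, f, g, h, rfl⟩
    exact ⟨a * e - b * f - c * g - d * h, a * f + b * e + c * h - d * g,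
      a * g - b * h + c * e + d * f, a * h + b * g - c * f + d * e, by ext <;> simp⟩

lemma star_mem_quatIntSubring {q : ℍ[ℝ]} (h : q ∈ quatIntSubring) : star q ∈ quatIntSubring := by
  obtain ⟨a, b, c, d, rfl⟩ := mem_quatInt.1 h
  exact ⟨a, -b, -c, -d, by ext <;> simp⟩

lemma studyAdj_mem_matrix {M : M2 ℍ[ℝ]} (hM : M ∈ quatIntSubring.matrix) :
    studyAdj M ∈ quatIntSubring.matrix := by
  have hM' : Mᴴ ∈ quatIntSubring.matrix := fun r s => star_mem_quatIntSubring (hM s r)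
  have hH : M * Mᴴ ∈ quatIntSubring.matrix := mul_mem hM hM'
  refine mul_mem hM' fun r s => ?_
  fin_cases r <;> fin_cases s
  exacts [hH 1 1, quatIntSubring.neg_mem (hH 0 1), quatIntSubring.neg_mem (hH 1 0), hH 0 0]

end IntegralQuaternions

section Reversion

lemma rev_mul {n : ℕ} (x y : Cliff n) : rev (x * y) = rev y * rev x :=
  CliffordAlgebra.reverse.map_mul x y

lemma rev_one {n : ℕ} : rev (1 : Cliff n) = 1 :=
  CliffordAlgebra.reverse.map_one

lemma rev_eq_self_of_mem_vectors {n : ℕ} {x : Cliff n} (hx : x ∈ vectors n) : rev x = x := by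
  induction hx using Submodule.span_induction with
  | mem x hx =>
    rcases hx with rfl | ⟨h, rfl⟩
    · exact rev_one
    · exact CliffordAlgebra.reverse_ι _
  | zero => exact map_zero _
  | add x y _ _ hx hy => rw [rev, map_add, ← rev, ← rev, hx, hy]
  | smul r x _ hx => rw [rev, map_smul, ← rev, hx]

lemma intVectors_le_vectors {n : ℕ} {x : Cliff n} (hx : x ∈ intVectors n) : x ∈ vectors n :=
  Submodule.span_le_restrictScalars ℤ ℝ _ hx

lemma intCast_smul_mem_intVectors {n : ℕ} {x : Cliff n} (m : ℤ) (hx : x ∈ intVectors n) :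
    (m : ℝ) • x ∈ intVectors n :=
  Int.cast_smul_eq_zsmul ℝ m x ▸ Submodule.smul_mem _ m hx

/-- The anti-automorphism of `ℍ(ℝ)` that fixes `i` and `j` and sends `k` to `-k`. Under `ω` it is
the reversion of `Cliff_3(ℝ)`. -/
def tau (q : ℍ[ℝ]) : ℍ[ℝ] := quat q.re q.imI q.imJ (-q.imK)

lemma tau_tau (q : ℍ[ℝ]) : tau (tau q) = q := by ext <;> simp [tau]

lemma tau_mul (p q : ℍ[ℝ]) : tau (p * q) = tau q * tau p := by
  ext <;> simp only [tau, quat_re, quat_imI, quat_imJ, quat_imK, Quaternion.re_mul,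
    Quaternion.imI_mul, Quaternion.imJ_mul, Quaternion.imK_mul] <;> ring

lemma tau_add (p q : ℍ[ℝ]) : tau (p + q) = tau p + tau q := by
  ext <;> simp [tau, add_comm]

lemma tau_mem_quatIntSubring {q : ℍ[ℝ]} : tau q ∈ quatIntSubring ↔ q ∈ quatIntSubring := by
  suffices ∀ q ∈ quatIntSubring, tau q ∈ quatIntSubring from
    ⟨fun h => tau_tau q ▸ this _ h, this q⟩
  intro q hq
  obtain ⟨a, b, c, d, rfl⟩ := mem_quatInt.1 hq
  exact ⟨a, b, c, -d, by ext <;> simp [tau]⟩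

lemma chi1_rev (x : Cliff 4) : chi1 (rev x) = tau (chi2 x) := by
  induction x using CliffordAlgebra.induction with
  | algebraMap r =>
    rw [rev, CliffordAlgebra.reverse.commutes, AlgHom.commutes, AlgHom.commutes]
    ext <;> simp [tau]
  | ι v =>
    rw [rev, CliffordAlgebra.reverse_ι, chi1, chi2, CliffordAlgebra.lift_ι_apply,
      CliffordAlgebra.lift_ι_apply, chi1Lin_apply, chi2Lin_apply]
    ext <;> simp [tau]
  | mul a b ha hb => rw [rev_mul, map_mul, map_mul, tau_mul, ha, hb]
  | add a b ha hb => rw [rev, map_add, map_add, map_add, tau_add, ha, hb]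

lemma eq_of_chi1_eq {x y : Cliff 4} (h : chi1 x = chi1 y) (hrev : chi1 (rev x) = chi1 (rev y)) :
    x = y := by
  obtain ⟨a, b, rfl⟩ := exists_eps x
  obtain ⟨c, d, rfl⟩ := exists_eps y
  rw [chi1_eps, chi1_eps] at h
  rw [chi1_rev, chi1_rev, chi2_eps, chi2_eps] at hrev
  rw [omega.injective h, omega.injective (Function.Involutive.injective tau_tau hrev)]

/-- The element of `Cliff_4(ℝ)` with given images under `χ_1` and `χ_1 ∘ *`. -/
def ofPair (p q : ℍ[ℝ]) : Cliff 4 :=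
  eps1 * incl (omega.symm p) + eps2 * incl (omega.symm (tau q))

@[simp] lemma chi1_ofPair (p q : ℍ[ℝ]) : chi1 (ofPair p q) = p := by
  rw [ofPair, chi1_eps, AlgEquiv.apply_symm_apply]

@[simp] lemma chi1_rev_ofPair (p q : ℍ[ℝ]) : chi1 (rev (ofPair p q)) = q := by
  rw [chi1_rev, ofPair, chi2_eps, AlgEquiv.apply_symm_apply, tau_tau]

/-- The Clifford vector in `𝕍⁴(ℝ)` with image `q` under `χ_1`. -/
def toVector (q : ℍ[ℝ]) : Cliff 4 :=
  q.re • 1 + q.imI • gen 4 (0 : Fin 3) + q.imJ • gen 4 (1 : Fin 3) + (-q.imK) • gen 4 (2 : Fin 3)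

lemma toVector_mem_vectors (q : ℍ[ℝ]) : toVector q ∈ vectors 4 := by
  have h1 : 1 ∈ vectors 4 := Submodule.subset_span (Set.mem_insert _ _)
  have hgen k : gen 4 k ∈ vectors 4 := Submodule.subset_span (Set.mem_insert_of_mem _ ⟨k, rfl⟩)
  exact add_mem (add_mem (add_mem (Submodule.smul_mem _ _ h1) (Submodule.smul_mem _ _ (hgen _)))
    (Submodule.smul_mem _ _ (hgen _))) (Submodule.smul_mem _ _ (hgen _))

@[simp] lemma chi1_toVector (q : ℍ[ℝ]) : chi1 (toVector q) = q := by
  simp only [toVector, map_add, map_smul, map_one, chi1_gen]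
  ext <;> simp

lemma rev_toVector (q : ℍ[ℝ]) : rev (toVector q) = toVector q :=
  rev_eq_self_of_mem_vectors (toVector_mem_vectors q)

lemma eq_toVector_of_rev_eq_self {x : Cliff 4} (hx : rev x = x) : x = toVector (chi1 x) :=
  eq_of_chi1_eq (by rw [chi1_toVector]) (by rw [rev_toVector, chi1_toVector, hx])

lemma mem_vectors_four {x : Cliff 4} : x ∈ vectors 4 ↔ rev x = x :=
  ⟨rev_eq_self_of_mem_vectors, fun h => eq_toVector_of_rev_eq_self h ▸ toVector_mem_vectors _⟩

lemma toVector_mem_intVectors {q : ℍ[ℝ]} (hq : q ∈ quatIntSubring) :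
    toVector q ∈ intVectors 4 := by
  have h1 : 1 ∈ intVectors 4 := Submodule.subset_span (Set.mem_insert _ _)
  have hgen k : gen 4 k ∈ intVectors 4 := Submodule.subset_span (Set.mem_insert_of_mem _ ⟨k, rfl⟩)
  obtain ⟨a, b, c, d, rfl⟩ := mem_quatInt.1 hq
  rw [toVector, quat_imK, ← Int.cast_neg]
  exact add_mem (add_mem (add_mem (intCast_smul_mem_intVectors a h1)
    (intCast_smul_mem_intVectors b (hgen _))) (intCast_smul_mem_intVectors c (hgen _)))
    (intCast_smul_mem_intVectors (-d) (hgen _))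

lemma chi1_mem_quatIntSubring {x : Cliff 4} (hx : x ∈ intVectors 4) :
    chi1 x ∈ quatIntSubring := by
  have hgen (k : Fin 3) : chi1 (gen 4 k) ∈ quatIntSubring := by
    fin_cases k
    · exact mem_quatInt.2 ⟨0, 1, 0, 0, by simpa using chi1_gen.1⟩
    · exact mem_quatInt.2 ⟨0, 0, 1, 0, by simpa using chi1_gen.2.1⟩
    · exact mem_quatInt.2 ⟨0, 0, 0, -1, by simpa using chi1_gen.2.2⟩
  induction hx using Submodule.span_induction with
  | mem x hx =>
    rcases hx with rfl | ⟨k, rfl⟩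
    · rw [map_one]; exact one_mem _
    · exact hgen k
  | zero => rw [map_zero]; exact zero_mem _
  | add x y _ _ hx hy => rw [map_add]; exact add_mem hx hy
  | smul m x _ hx => rw [map_zsmul]; exact zsmul_mem hx m

lemma mem_intVectors_four {x : Cliff 4} :
    x ∈ intVectors 4 ↔ rev x = x ∧ chi1 x ∈ quatIntSubring :=
  ⟨fun hx => ⟨rev_eq_self_of_mem_vectors (intVectors_le_vectors hx), chi1_mem_quatIntSubring hx⟩,
    fun ⟨hrev, hint⟩ => eq_toVector_of_rev_eq_self hrev ▸ toVector_mem_intVectors hint⟩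

end Reversion

section CliffordGroup

open Quaternion

lemma isUnit_toVector {q : ℍ[ℝ]} (hq : q ≠ 0) : IsUnit (toVector q) := by
  have hmul : ∀ p : ℍ[ℝ], p ≠ 0 → toVector p * toVector p⁻¹ = 1 := fun p hp =>
    eq_of_chi1_eq (by simp [hp]) (by
      rw [rev_mul, rev_toVector, rev_toVector, rev_one]
      simp [hp])
  exact ⟨⟨_, _, hmul q hq, by simpa using hmul q⁻¹ (inv_ne_zero hq)⟩, rfl⟩

lemma toVector_mem_cliffGroup {q : ℍ[ℝ]} (hq : q ≠ 0) : toVector q ∈ cliffGroup 4 :=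
  Submonoid.subset_closure ⟨toVector_mem_vectors q, isUnit_toVector hq⟩

lemma normSq_chi1_rev_of_mem_cliffGroup {x : Cliff 4} (hx : x ∈ cliffGroup 4) :
    normSq (chi1 (rev x)) = normSq (chi1 x) := by
  induction hx using Submonoid.closure_induction with
  | mem x hx => rw [rev_eq_self_of_mem_vectors hx.1]
  | one => rw [rev_one]
  | mul x y _ _ hx hy =>
    rw [rev_mul, map_mul, map_mul, map_mul, map_mul, hx, hy, mul_comm]

-- Pairs multiply as `(p, q) (p', q') = (p p', q' q)`, so a product of vectors with trivial first
-- coordinate can have any commutator as its second.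
lemma mem_cliffGroup_of_normSq_eq {x : Cliff 4} (h : normSq (chi1 (rev x)) = normSq (chi1 x))
    (hx : chi1 x ≠ 0) : x ∈ cliffGroup 4 := by
  obtain ⟨p, q, hpq⟩ := exists_commutatorElement_eq (u := chi1 (rev x) * (chi1 x)⁻¹) (by
    rw [map_mul, h, normSq_inv, mul_inv_cancel₀ (normSq_ne_zero.2 hx)])
  have hfactor : x = toVector (chi1 x) * toVector q⁻¹ * toVector p⁻¹ * toVector (p * q) := by
    refine eq_of_chi1_eq (by simp [mul_assoc]) ?_
    calc chi1 (rev x) = ↑(p * q * p⁻¹ * q⁻¹) * chi1 x := by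
          rw [← commutatorElement_def, hpq, inv_mul_cancel_right₀ hx]
      _ = chi1 (rev (toVector (chi1 x) * toVector q⁻¹ * toVector p⁻¹ * toVector (p * q))) := by
          simp only [rev_mul, rev_toVector, map_mul, chi1_toVector, Units.val_mul,
            Units.val_inv_eq_inv_val, mul_assoc]
  rw [hfactor]
  exact mul_mem (mul_mem (mul_mem (toVector_mem_cliffGroup hx)
    (toVector_mem_cliffGroup (inv_ne_zero q.ne_zero)))
    (toVector_mem_cliffGroup (inv_ne_zero p.ne_zero)))
    (toVector_mem_cliffGroup (mul_ne_zero p.ne_zero q.ne_zero))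

lemma mem_cliffGroup_four_or_eq_zero {x : Cliff 4} :
    x ∈ cliffGroup 4 ∨ x = 0 ↔ normSq (chi1 (rev x)) = normSq (chi1 x) := by
  constructor
  · rintro (hx | rfl)
    · exact normSq_chi1_rev_of_mem_cliffGroup hx
    · rw [rev, map_zero]
  · intro h
    by_cases hx : chi1 x = 0
    · rw [hx, map_zero, normSq_eq_zero] at h
      exact Or.inr (eq_of_chi1_eq (by rw [hx, map_zero]) (by rw [h, rev, map_zero, map_zero]))
    · exact Or.inl (mem_cliffGroup_of_normSq_eq h hx)

lemma omega_mem_quatIntSubring {a : Cliff 3} :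
    omega a ∈ quatIntSubring ↔ a ∈ cliffThreeInt := by
  constructor
  · rintro ⟨x, y, z, w, h⟩
    have hsmul (m : ℤ) {b : Cliff 3} (hb : b ∈ cliffThreeInt) : (m : ℝ) • b ∈ cliffThreeInt :=
      Int.cast_smul_eq_zsmul ℝ m b ▸ Submodule.smul_mem _ m hb
    have ha : a = omegaInv (quat x y z w) := (omega.symm_apply_apply a).symm.trans (by rw [h]; rfl)
    rw [ha, omegaInv_apply, Algebra.algebraMap_eq_smul_one]
    refine add_mem (add_mem (add_mem (hsmul x ?_) (hsmul y ?_)) (hsmul z ?_)) (hsmul w ?_) <;>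
      exact Submodule.subset_span (by simp)
  · intro h
    induction h using Submodule.span_induction with
    | mem x hx =>
      rcases hx with rfl | rfl | rfl | rfl
      · rw [map_one]; exact one_mem _
      · exact mem_quatInt.2 ⟨0, 1, 0, 0, by simpa using omega_gen.1⟩
      · exact mem_quatInt.2 ⟨0, 0, 1, 0, by simpa using omega_gen.2.1⟩
      · exact mem_quatInt.2 ⟨0, 0, 0, 1, by rw [omega_gen.2.2]; simp⟩
    | zero => rw [map_zero]; exact zero_mem _
    | add x y _ _ hx hy => rw [map_add]; exact add_mem hx hy
    | smul m x _ hx => rw [map_zsmul]; exact zsmul_mem hx m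

lemma mem_gammaTilde {x : Cliff 4} : x ∈ gammaTilde ↔
    x ∈ cliffGroup 4 ∧ chi1 x ∈ quatIntSubring ∧ chi1 (rev x) ∈ quatIntSubring := by
  rw [chi1_rev, tau_mem_quatIntSubring]
  refine and_congr_right fun _ => ⟨?_, fun ⟨h1, h2⟩ => ?_⟩
  · rintro ⟨a, ha, b, hb, rfl⟩
    rw [chi1_eps, chi2_eps]
    exact ⟨omega_mem_quatIntSubring.2 ha, omega_mem_quatIntSubring.2 hb⟩
  · obtain ⟨a, b, rfl⟩ := exists_eps x
    rw [chi1_eps] at h1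
    rw [chi2_eps] at h2
    exact ⟨a, omega_mem_quatIntSubring.1 h1, b, omega_mem_quatIntSubring.1 h2, rfl⟩

lemma mem_gammaTilde_or_eq_zero {x : Cliff 4} : x ∈ gammaTilde ∨ x = 0 ↔
    (x ∈ cliffGroup 4 ∨ x = 0) ∧ chi1 x ∈ quatIntSubring ∧ chi1 (rev x) ∈ quatIntSubring := by
  rw [mem_gammaTilde]
  constructor
  · rintro (hx | rfl)
    · exact ⟨Or.inl hx.1, hx.2⟩
    · simp [zero_mem]
  · rintro ⟨hx | hx, hint⟩
    · exact Or.inl ⟨hx, hint⟩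
    · exact Or.inr hx

end CliffordGroup

section Dagger

/-- The adjugate `(δ*, -β*; -γ*, α*)` of a matrix `(α, β; γ, δ)` over a Clifford algebra. -/
def dagger {n : ℕ} (M : M2 (Cliff n)) : M2 (Cliff n) :=
  !![rev (M 1 1), -rev (M 0 1); -rev (M 1 0), rev (M 0 0)]

variable {n : ℕ} (M N : M2 (Cliff n))

lemma dagger_rev_rev (r s : Fin 2) :
    dagger M s.rev r.rev = (-1) ^ (r + s : ℕ) * rev (M r s) := by
  fin_cases r <;> fin_cases s <;> simp [dagger]

lemma dagger_dagger : dagger (dagger M) = M := by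
  ext1 r s
  fin_cases r <;> fin_cases s <;> simp [dagger]

lemma dagger_mul : dagger (M * N) = dagger N * dagger M := by
  ext1 r s
  fin_cases r <;> fin_cases s <;>
    simp [dagger, Matrix.mul_apply, Fin.sum_univ_two, add_comm]

lemma dagger_one : dagger (1 : M2 (Cliff n)) = 1 := by
  ext1 r s
  fin_cases r <;> fin_cases s <;> simp [dagger]

variable {M}

lemma mul_dagger_eq_one_iff : M * dagger M = 1 ↔ vahlenDet M = 1 ∧
    rev (M 0 0 * rev (M 0 1)) = M 0 0 * rev (M 0 1) ∧
    rev (M 1 0 * rev (M 1 1)) = M 1 0 * rev (M 1 1) := by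
  have hentries : M * dagger M =
      !![vahlenDet M, rev (M 0 0 * rev (M 0 1)) - M 0 0 * rev (M 0 1);
        M 1 0 * rev (M 1 1) - rev (M 1 0 * rev (M 1 1)), rev (vahlenDet M)] := by
    ext1 r s
    fin_cases r <;> fin_cases s <;>
      simp [dagger, vahlenDet, Matrix.mul_apply, sub_eq_add_neg, add_comm]
  rw [hentries, ← Matrix.ext_iff, Fin.forall_fin_two, Fin.forall_fin_two, Fin.forall_fin_two]
  simp only [Matrix.of_apply, Matrix.cons_val_zero, Matrix.cons_val_one, Matrix.cons_val',
    Matrix.cons_val_fin_one, Matrix.one_apply, if_true, zero_ne_one, one_ne_zero, if_false,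
    sub_eq_zero]
  exact ⟨fun h => ⟨h.1.1, h.1.2, h.2.1.symm⟩,
    fun h => ⟨⟨h.1, h.2.1⟩, h.2.2.symm, by rw [h.1, rev_one]⟩⟩

lemma rev_eq_self_of_dagger_mul_eq_one (h : dagger M * M = 1) :
    rev (rev (M 1 0) * M 0 0) = rev (M 1 0) * M 0 0 ∧
      rev (rev (M 1 1) * M 0 1) = rev (M 1 1) * M 0 1 := by
  have hM : dagger M * dagger (dagger M) = 1 := by rw [dagger_dagger, h]
  obtain ⟨-, h01, h10⟩ := mul_dagger_eq_one_iff.1 hM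
  constructor
  · simpa [dagger] using h10
  · simpa [dagger] using h01

end Dagger

section Lift

open Quaternion

lemma chiTilde_apply (M : M2 (Cliff 4)) (r s : Fin 2) : chiTilde M r s = chi1 (M r s) := rfl

lemma chiTilde_dagger_rev_rev (M : M2 (Cliff 4)) (r s : Fin 2) :
    chiTilde (dagger M) s.rev r.rev = (-1) ^ (r + s : ℕ) * chi1 (rev (M r s)) := by
  rw [chiTilde_apply, dagger_rev_rev, map_mul, map_pow, map_neg, map_one]

lemma eq_of_chiTilde_eq {M N : M2 (Cliff 4)} (h : chiTilde M = chiTilde N)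
    (hdagger : chiTilde (dagger M) = chiTilde (dagger N)) : M = N := by
  ext1 r s
  refine eq_of_chi1_eq (congrFun₂ h r s) ?_
  have hrs := congrFun₂ hdagger s.rev r.rev
  rw [chiTilde_dagger_rev_rev, chiTilde_dagger_rev_rev] at hrs
  exact mul_left_cancel₀ (pow_ne_zero _ (neg_ne_zero.2 one_ne_zero)) hrs

/-- The matrix `M` over `Cliff_4(ℝ)` with `χ̃ M = P` and `χ̃ M† = Q`. -/
def matrixOfPair (P Q : M2 ℍ[ℝ]) : M2 (Cliff 4) :=
  Matrix.of fun r s => ofPair (P r s) ((-1) ^ (r + s : ℕ) * Q s.rev r.rev)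

lemma chiTilde_matrixOfPair (P Q : M2 ℍ[ℝ]) : chiTilde (matrixOfPair P Q) = P := by
  ext1 r s
  rw [chiTilde_apply, matrixOfPair, Matrix.of_apply, chi1_ofPair]

lemma chiTilde_dagger_matrixOfPair (P Q : M2 ℍ[ℝ]) :
    chiTilde (dagger (matrixOfPair P Q)) = Q := by
  ext1 r s
  have hrs := chiTilde_dagger_rev_rev (matrixOfPair P Q) s.rev r.rev
  rw [show matrixOfPair P Q s.rev r.rev = ofPair _ _ from rfl, chi1_rev_ofPair, ← mul_assoc,
    ← pow_add, Even.neg_one_pow ⟨_, rfl⟩, one_mul] at hrs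
  simpa only [Fin.rev_rev] using hrs

/-- The embedding of `GL_2(ℍ(ℝ))` into `M_2(Cliff_4(ℝ))` whose values are the matrices `M` with
`M M† = 1`; it is inverse to `χ̃` there. -/
def lift : (M2 ℍ[ℝ])ˣ →* M2 (Cliff 4) where
  toFun v := matrixOfPair v.val v⁻¹.val
  map_one' := eq_of_chiTilde_eq (by rw [chiTilde_matrixOfPair, map_one, Units.val_one])
    (by rw [chiTilde_dagger_matrixOfPair, dagger_one, map_one, inv_one, Units.val_one])
  map_mul' v w := eq_of_chiTilde_eq
    (by simp only [chiTilde_matrixOfPair, map_mul, Units.val_mul])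
    (by simp only [chiTilde_dagger_matrixOfPair, dagger_mul, map_mul, mul_inv_rev, Units.val_mul])

lemma chiTilde_lift (v : (M2 ℍ[ℝ])ˣ) : chiTilde (lift v) = v.val :=
  chiTilde_matrixOfPair _ _

lemma chiTilde_dagger_lift (v : (M2 ℍ[ℝ])ˣ) : chiTilde (dagger (lift v)) = v⁻¹.val :=
  chiTilde_dagger_matrixOfPair _ _

lemma lift_injective : Function.Injective lift := fun v w h =>
  Units.ext (by rw [← chiTilde_lift, h, chiTilde_lift])

lemma dagger_lift (v : (M2 ℍ[ℝ])ˣ) : dagger (lift v) = lift v⁻¹ :=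
  eq_of_chiTilde_eq (by rw [chiTilde_dagger_lift, chiTilde_lift])
    (by rw [dagger_dagger, chiTilde_lift, chiTilde_dagger_lift, inv_inv])

lemma lift_mul_dagger (v : (M2 ℍ[ℝ])ˣ) : lift v * dagger (lift v) = 1 := by
  rw [dagger_lift, ← map_mul, mul_inv_cancel, map_one]

lemma dagger_mul_lift (v : (M2 ℍ[ℝ])ˣ) : dagger (lift v) * lift v = 1 := by
  rw [dagger_lift, ← map_mul, inv_mul_cancel, map_one]

lemma exists_lift_eq {M : M2 (Cliff 4)} (h : M * dagger M = 1) : ∃ v, lift v = M := by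
  have hχ : chiTilde M * chiTilde (dagger M) = 1 := by rw [← map_mul, h, map_one]
  exact ⟨⟨chiTilde M, chiTilde (dagger M), hχ, mul_eq_one_comm.1 hχ⟩,
    eq_of_chiTilde_eq (chiTilde_lift _) (chiTilde_dagger_lift _)⟩

lemma apply_mem_cliffGroup_or_eq_zero {M : M2 (Cliff 4)} {r s : Fin 2} :
    M r s ∈ cliffGroup 4 ∨ M r s = 0 ↔
      normSq (chiTilde (dagger M) s.rev r.rev) = normSq (chiTilde M r s) := by
  rw [mem_cliffGroup_four_or_eq_zero, chiTilde_dagger_rev_rev, map_mul, map_pow, normSq_neg,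
    map_one, one_pow, one_mul, chiTilde_apply]

lemma exists_lift_eq_of_mem_SLPlus {M : M2 (Cliff 4)} (hM : M ∈ SLPlus 4) : ∃ v, lift v = M := by
  obtain ⟨⟨-, -, h01, h10, -, -⟩, hdet⟩ := hM
  exact exists_lift_eq (mul_dagger_eq_one_iff.2
    ⟨hdet, rev_eq_self_of_mem_vectors h01, rev_eq_self_of_mem_vectors h10⟩)

lemma lift_mem_SLPlus {v : (M2 ℍ[ℝ])ˣ} : lift v ∈ SLPlus 4 ↔ v.val ∈ SL2Real := by
  have hentries : (∀ r s, lift v r s ∈ cliffGroup 4 ∨ lift v r s = 0) ↔ v.val ∈ SL2Real := by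
    simp only [apply_mem_cliffGroup_or_eq_zero, chiTilde_lift, chiTilde_dagger_lift]
    rw [mem_SL2Real_iff_normSq_eq v.mul_inv]
    exact ⟨fun h r s => by simpa using h s.rev r.rev, fun h r s => by simpa using h s.rev r.rev⟩
  obtain ⟨hdet, h01, h10⟩ := mul_dagger_eq_one_iff.1 (lift_mul_dagger v)
  obtain ⟨h01', h10'⟩ := rev_eq_self_of_dagger_mul_eq_one (dagger_mul_lift v)
  rw [← hentries]
  exact ⟨fun h => h.1.1, fun h => ⟨⟨h, hdet ▸ one_ne_zero, mem_vectors_four.2 h01,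
    mem_vectors_four.2 h10, mem_vectors_four.2 h01', mem_vectors_four.2 h10'⟩, hdet⟩⟩

lemma chi1_rev_mem_quatIntSubring {M : M2 (Cliff 4)} {r s : Fin 2} :
    chi1 (rev (M r s)) ∈ quatIntSubring ↔
      chiTilde (dagger M) s.rev r.rev ∈ quatIntSubring := by
  rw [chiTilde_dagger_rev_rev]
  obtain h | h := neg_one_pow_eq_or ℍ[ℝ] (r + s : ℕ) <;> simp [h]

lemma mem_SLPlusTilde {M : M2 (Cliff 4)} : M ∈ SLPlusTilde ↔ M ∈ SLPlus 4 ∧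
    chiTilde M ∈ quatIntSubring.matrix ∧ chiTilde (dagger M) ∈ quatIntSubring.matrix := by
  constructor
  · rintro ⟨hM, hdet, h1, h2, h3, h4⟩
    have hM' := fun r s => mem_gammaTilde_or_eq_zero.1 (hM r s)
    refine ⟨⟨⟨fun r s => (hM' r s).1, hdet ▸ one_ne_zero, intVectors_le_vectors h1,
      intVectors_le_vectors h2, intVectors_le_vectors h3, intVectors_le_vectors h4⟩, hdet⟩,
      fun r s => (hM' r s).2.1, fun r s => ?_⟩
    simpa using chi1_rev_mem_quatIntSubring.1 (hM' s.rev r.rev).2.2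
  · rintro ⟨⟨⟨hM, -, h1, h2, h3, h4⟩, hdet⟩, hint, hint'⟩
    have hrev := fun r s => chi1_rev_mem_quatIntSubring.2 (hint' (Fin.rev s) (Fin.rev r))
    have hmul {x y : Cliff 4} (hxy : x * y ∈ vectors 4) (hx : chi1 x ∈ quatIntSubring)
        (hy : chi1 y ∈ quatIntSubring) : x * y ∈ intVectors 4 :=
      mem_intVectors_four.2 ⟨mem_vectors_four.1 hxy, map_mul chi1 x y ▸ mul_mem hx hy⟩
    exact ⟨fun r s => mem_gammaTilde_or_eq_zero.2 ⟨hM r s, hint r s, hrev r s⟩, hdet,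
      hmul h1 (hint 0 0) (hrev 0 1), hmul h2 (hint 1 0) (hrev 1 1),
      hmul h3 (hrev 1 0) (hint 0 0), hmul h4 (hrev 1 1) (hint 0 1)⟩

end Lift

section Groups

/-- The group `SL_2(ℍ(ℝ))`. -/
def SL2RealGroup : Subgroup (M2 ℍ[ℝ])ˣ :=
  (studyDet.comp (Units.coeHom (M2 ℍ[ℝ]))).ker

/-- The group `SL_2(ℍ(ℤ))`. Integrality of the inverse is part of the definition, but is automatic
(`mem_SL2IntGroup`). -/
def SL2IntGroup : Subgroup (M2 ℍ[ℝ])ˣ :=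
  SL2RealGroup ⊓ quatIntSubring.matrix.toSubmonoid.units

lemma mem_SL2RealGroup {v : (M2 ℍ[ℝ])ˣ} : v ∈ SL2RealGroup ↔ v.val ∈ SL2Real :=
  mem_SL2Real.symm

lemma mem_SL2IntGroup {v : (M2 ℍ[ℝ])ˣ} : v ∈ SL2IntGroup ↔ v.val ∈ SL2Int := by
  refine ⟨fun ⟨hv, hint⟩ => ⟨hint.1, mem_SL2RealGroup.1 hv⟩,
    fun ⟨hint, hv⟩ => ⟨mem_SL2RealGroup.2 hv, hint, ?_⟩⟩
  have hadj : v.val * studyAdj v.val = 1 := by rw [mul_studyAdj, mem_SL2Real.1 hv, one_smul]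
  change v⁻¹.val ∈ quatIntSubring.matrix
  rw [Units.inv_eq_of_mul_eq_one_right hadj]
  exact studyAdj_mem_matrix hint

lemma isUnit_of_mem_SL2Real {M : M2 ℍ[ℝ]} (hM : M ∈ SL2Real) : IsUnit M :=
  .of_mul_eq_one (studyAdj M) (by rw [mul_studyAdj, mem_SL2Real.1 hM, one_smul])

lemma image_val_SL2RealGroup : Units.val '' (SL2RealGroup : Set (M2 ℍ[ℝ])ˣ) = SL2Real := by
  have h : (SL2RealGroup : Set (M2 ℍ[ℝ])ˣ) = Units.val ⁻¹' SL2Real :=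
    Set.ext fun _ => mem_SL2RealGroup
  rw [h, Set.image_preimage_eq_of_subset]
  exact fun M hM => isUnit_of_mem_SL2Real hM

lemma image_val_SL2IntGroup : Units.val '' (SL2IntGroup : Set (M2 ℍ[ℝ])ˣ) = SL2Int := by
  have h : (SL2IntGroup : Set (M2 ℍ[ℝ])ˣ) = Units.val ⁻¹' SL2Int :=
    Set.ext fun _ => mem_SL2IntGroup
  rw [h, Set.image_preimage_eq_of_subset]
  exact fun M hM => isUnit_of_mem_SL2Real hM.2

lemma image_lift_SL2RealGroup : lift '' SL2RealGroup = SLPlus 4 := by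
  have h : (SL2RealGroup : Set (M2 ℍ[ℝ])ˣ) = lift ⁻¹' SLPlus 4 :=
    Set.ext fun _ => mem_SL2RealGroup.trans lift_mem_SLPlus.symm
  rw [h, Set.image_preimage_eq_of_subset]
  exact fun M hM => exists_lift_eq_of_mem_SLPlus hM

lemma lift_mem_SLPlusTilde {v : (M2 ℍ[ℝ])ˣ} : lift v ∈ SLPlusTilde ↔ v ∈ SL2IntGroup := by
  rw [mem_SLPlusTilde, lift_mem_SLPlus, ← mem_SL2RealGroup, chiTilde_lift, chiTilde_dagger_lift]
  rfl

lemma image_lift_SL2IntGroup : lift '' SL2IntGroup = SLPlusTilde := by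
  have h : (SL2IntGroup : Set (M2 ℍ[ℝ])ˣ) = lift ⁻¹' SLPlusTilde :=
    Set.ext fun _ => lift_mem_SLPlusTilde.symm
  rw [h, Set.image_preimage_eq_of_subset]
  exact fun M hM => exists_lift_eq_of_mem_SLPlus (mem_SLPlusTilde.1 hM).1

lemma image_val_map_toHomUnits {G M : Type*} [Group G] [Monoid M] (f : G →* M) (H : Subgroup G) :
    Units.val '' (H.map f.toHomUnits : Set Mˣ) = f '' H := by
  rw [Subgroup.coe_map, Set.image_image]
  rfl

lemma toHomUnits_injective {G M : Type*} [Group G] [Monoid M] {f : G →* M}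
    (hf : Function.Injective f) : Function.Injective f.toHomUnits :=
  fun _ _ h => hf (congrArg Units.val h)

end Groups

end CliffordSL

end

theorem mainTheorem4 :
    ∃ (G GZ : Subgroup (CliffordSL.M2 (CliffordSL.Cliff 4))ˣ)
      (H HZ : Subgroup (CliffordSL.M2 (Quaternion ℝ))ˣ),
      Units.val '' (G : Set (CliffordSL.M2 (CliffordSL.Cliff 4))ˣ) = CliffordSL.SLPlus 4 ∧
      Units.val '' (GZ : Set (CliffordSL.M2 (CliffordSL.Cliff 4))ˣ) = CliffordSL.SLPlusTilde ∧
      Units.val '' (H : Set (CliffordSL.M2 (Quaternion ℝ))ˣ) = CliffordSL.SL2Real ∧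
      Units.val '' (HZ : Set (CliffordSL.M2 (Quaternion ℝ))ˣ) = CliffordSL.SL2Int ∧
      ∃ (hG : GZ ≤ G) (hH : HZ ≤ H) (χ : G ≃* H) (χZ : GZ ≃* HZ),
        (∀ M : G, (χ M).1.val = CliffordSL.chiTilde M.1.val) ∧
        ∀ M : GZ, Subgroup.inclusion hH (χZ M) = χ (Subgroup.inclusion hG M) := by
  open CliffordSL in
  have hinj := toHomUnits_injective lift_injective
  have hH : SL2IntGroup ≤ SL2RealGroup := inf_le_left
  let e := SL2RealGroup.equivMapOfInjective lift.toHomUnits hinj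
  let eZ := SL2IntGroup.equivMapOfInjective lift.toHomUnits hinj
  refine ⟨SL2RealGroup.map lift.toHomUnits, SL2IntGroup.map lift.toHomUnits,
    SL2RealGroup, SL2IntGroup,
    (image_val_map_toHomUnits _ _).trans image_lift_SL2RealGroup,
    (image_val_map_toHomUnits _ _).trans image_lift_SL2IntGroup,
    image_val_SL2RealGroup, image_val_SL2IntGroup,
    Subgroup.map_mono hH, hH, e.symm, eZ.symm, fun M => ?_, fun M => ?_⟩
  · obtain ⟨v, rfl⟩ := e.surjective M
    rw [e.symm_apply_apply]
    exact (chiTilde_lift v).symm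
  · obtain ⟨v, rfl⟩ := eZ.surjective M
    rw [eZ.symm_apply_apply]
    exact (e.symm_apply_apply (Subgroup.inclusion hH v)).symm
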